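/- A pospace is a topological space $X$ equipped with a partial order $\leq$ on its underlying set (the order is not required to be closed in $X\times X$). A dimap $(X,\leq)\to(Y,\leq)$ is a continuous map which is order preserving ($x\leq x'$ implies $f(x)\leq f(x')$). Let $\mathbf{poTop}$ be the category of pospaces and dimaps. Let $I=[0,1]$ with its usual topology, and let $(I,\Delta)$ be the pospace whose partial order is the diagonal $\Delta$, i.e. equality; products of pospaces carry the product topology and the componentwise order. Two dimaps $f,g:(X,\leq)\to(Y,\leq)$ are dihomotopic if there is a dimap $H:(X,\leq)\times(I,\Delta)\to(Y,\leq)$ with $H(x,0)=f(x)$ and $H(x,1)=g(x)$ for all $x\in X$. A dimap $f:(X,\leq)\to(Y,\leq)$ is a dihomotopy equivalence if there is a dimap $g:(Y,\leq)\to(X,\leq)$ such that $f\circ g$ is dihomotopic to $\mathrm{id}_{(Y,\leq)}$ and $g\circ f$ is dihomotopic to $\mathrm{id}_{(X,\leq)}$. A difibration is a dimap having the right lifting property with respect to the dimaps $i_0:(X,\leq)\to(X,\leq)\times(I,\Delta)$, $i_0(x)=(x,0)$, for all pospaces $(X,\leq)$. A dicofibration is a dimap having the left lifting property with respect to all difibrations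 that are dihomotopy equivalences. **Theorem 8.2.** The category $\mathbf{poTop}$ is a closed model category (in the sense of Quillen, with the axioms CM1–CM5 as in Goerss–Jardine, *Simplicial Homotopy Theory*) in which the weak equivalences are the dihomotopy equivalences, the fibrations are the difibrations, and the cofibrations are the dicofibrations. All pospaces are fibrant and cofibrant. Two dimaps are homotopic in the closed model category $\mathbf{poTop}$ (equivalently left homotopic, equivalently right homotopic) if and only if they are dihomotopic. -/

import Mathlib

open CategoryTheory HomotopicalAlgebra

universe u

/-- A pospace: a topological space equipped with a partial order. No compatibility between the
topology and the order is required. -/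
structure PoTop : Type (u + 1) where
  /-- The pospace on a type that carries a topology and a partial order. -/
  of ::
  /-- The underlying type. -/
  carrier : Type u
  [topologicalSpace : TopologicalSpace carrier]
  [partialOrder : PartialOrder carrier]

namespace PoTop

attribute [instance] topologicalSpace partialOrder

instance : CoeSort PoTop.{u} (Type u) := ⟨carrier⟩

/-- A dimap: a continuous map which is monotone. -/
@[ext]
structure Hom (X Y : PoTop.{u}) where
  /-- The underlying continuous monotone map. -/
  hom' : X →Co Y

/-- The category of pospaces and dimaps. -/
instance : Category PoTop.{u} where
  Hom X Y := Hom X Y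
  id X := ⟨ContinuousOrderHom.id X⟩
  comp f g := ⟨g.hom'.comp f.hom'⟩

instance : ConcreteCategory PoTop.{u} (fun X Y => X →Co Y) where
  hom f := f.hom'
  ofHom f := ⟨f⟩

/-- The dimap given by a continuous monotone map. -/
abbrev ofHom {X Y : Type u} [TopologicalSpace X] [PartialOrder X] [TopologicalSpace Y]
    [PartialOrder Y] (f : X →Co Y) : PoTop.of X ⟶ PoTop.of Y :=
  ConcreteCategory.ofHom f

/-- The pospace `(S, Δ)`: the space `S` with the diagonal (equality) as its partial order. -/
def Diag (S : Type*) : Type _ := S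

namespace Diag

instance (S : Type*) [TopologicalSpace S] : TopologicalSpace (Diag S) :=
  inferInstanceAs (TopologicalSpace S)

instance (S : Type*) : PartialOrder (Diag S) where
  le s t := s = t
  le_refl _ := rfl
  le_trans _ _ _ h h' := h.trans h'
  le_antisymm _ _ h _ := h

/-- A point of `S`, as a point of `(S, Δ)`. -/
def mk {S : Type*} (s : S) : Diag S := s

end Diag

/-- The cylinder `(X, ≤) × (I, Δ)` on a pospace: the product of `X` and the free unit interval,
with the product topology and the componentwise order. -/
abbrev cylinder (X : PoTop.{u}) : PoTop.{u} := PoTop.of (X × Diag unitInterval)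

/-- The inclusion `x ↦ (x, t)` of `X` into its cylinder, at the time `t`. -/
def incl (X : PoTop.{u}) (t : unitInterval) : X ⟶ X.cylinder :=
  ofHom
    { toFun := fun x => (x, Diag.mk t)
      monotone' := fun _ _ h => ⟨h, le_rfl⟩
      continuous_toFun := by fun_prop }

/-- Two dimaps `f, g : X ⟶ Y` are dihomotopic if there is a dimap `H : (X, ≤) × (I, Δ) ⟶ (Y, ≤)`
with `H (x, 0) = f x` and `H (x, 1) = g x` for all `x`. -/
def Dihomotopic {X Y : PoTop.{u}} (f g : X ⟶ Y) : Prop :=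
  ∃ H : X.cylinder ⟶ Y, ∀ x : X, H (x, Diag.mk 0) = f x ∧ H (x, Diag.mk 1) = g x

/-- The dihomotopy equivalences: the dimaps that have an inverse up to dihomotopy. -/
def dihomotopyEquivalences : MorphismProperty PoTop.{u} := fun X Y f =>
  ∃ g : Y ⟶ X, Dihomotopic (g ≫ f) (𝟙 Y) ∧ Dihomotopic (f ≫ g) (𝟙 X)

/-- The difibrations: the dimaps having the right lifting property with respect to the inclusions
`i₀ : X ⟶ X × (I, Δ)`, `i₀ x = (x, 0)`, of all pospaces `X`. -/
def difibrations : MorphismProperty PoTop.{u} :=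
  (MorphismProperty.ofHoms fun X : PoTop.{u} => X.incl 0).rlp

/-- The dicofibrations: the dimaps having the left lifting property with respect to the trivial
difibrations, that is, the difibrations which are dihomotopy equivalences. -/
def dicofibrations : MorphismProperty PoTop.{u} :=
  (difibrations ⊓ dihomotopyEquivalences).llp

end PoTop

/-! This is the Hurewicz–Strøm argument. It survives the order because time carries the equality
order: comparable points of a cylinder have the same time, so paths in `Y` are arbitrary, and the
cylinder is adjoint to the path space with pointwise order. Homotopies can be concatenated and
reparametrized as usual, provided any point-dependent time is constant along the order.

Every dimap factors through its Moore mapping path space. The end point map `mooreSpace.target` is a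
difibration, since a lift only has to lengthen the path. The inclusion `mooreSpace.const` of paths
of length zero is a dihomotopy equivalence, and it lifts against all difibrations because the length
is a continuous function vanishing exactly on its image. With paths of fixed duration no such
function is available in general.

The other factorization rests on `exists_section_of_trivial`: a trivial difibration deforms onto a
section within its fibres. Hence `exists_lift_of_ends` lifts a homotopy with both ends prescribed,
which makes the free end of a mapping cylinder a dicofibration. Applying the Moore factorization to
the retraction of the mapping cylinder then gives the factorization through a trivial difibration.
The retract argument identifies the trivial dicofibrations with `difibrations.llp`, and the lifting
axioms follow. -/

noncomputable section

namespace PoTop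

namespace Diag

/-- The point of `S` underlying a point of `(S, Δ)`. -/
def get {S : Type*} (s : Diag S) : S := s

@[simp] lemma get_mk {S : Type*} (s : S) : (mk s).get = s := rfl

lemma get_eq_of_le {S : Type*} {s t : Diag S} (h : s ≤ t) : s.get = t.get := h

@[fun_prop]
lemma continuous_mk {S : Type*} [TopologicalSpace S] : Continuous (mk : S → Diag S) :=
  continuous_id

@[fun_prop]
lemma continuous_get {S : Type*} [TopologicalSpace S] : Continuous (get : Diag S → S) :=
  continuous_id

end Diag

open Diag Limits
open scoped NNReal

/-- The dimap with a given continuous monotone underlying function. -/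
def mkHom {X Y : PoTop.{u}} (f : X → Y) (hc : Continuous f) (hm : ∀ x x', x ≤ x' → f x ≤ f x') : X ⟶ Y :=
  ConcreteCategory.ofHom (X := X) (Y := Y) ⟨⟨f, fun _ _ => hm _ _⟩, hc⟩

@[simp]
lemma mkHom_apply {X Y : PoTop.{u}} (f : X → Y) (hc : Continuous f) 
    (hm : ∀ x x', x ≤ x' → f x ≤ f x') (x : X) :
    mkHom f hc hm x = f x := rfl

@[fun_prop]
lemma continuous_hom {X Y : PoTop.{u}} (f : X ⟶ Y) : Continuous (fun x => f x) :=
  f.hom'.continuous_toFun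

lemma monotone_hom {X Y : PoTop.{u}} (f : X ⟶ Y) : Monotone f :=
  f.hom'.monotone'

/-- The nearest point retraction of the real line onto the unit interval. -/
def toI (r : ℝ) : unitInterval := Set.projIcc 0 1 zero_le_one r

@[fun_prop]
lemma continuous_toI : Continuous toI := continuous_projIcc (h := zero_le_one)

@[simp]
lemma toI_coe (t : unitInterval) : toI t = t := Set.projIcc_val _ _

lemma toI_of_le {r : ℝ} (h : r ≤ 0) : toI r = 0 := Set.projIcc_of_le_left _ h

lemma toI_of_ge {r : ℝ} (h : 1 ≤ r) : toI r = 1 := Set.projIcc_of_right_le _ h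

lemma coe_toI {r : ℝ} (h₀ : 0 ≤ r) (h₁ : r ≤ 1) : (toI r : ℝ) = r := by
  rw [toI, Set.projIcc_of_mem _ ⟨h₀, h₁⟩]

/-! ### Cylinders and the calculus of dihomotopies -/

section Cylinder

variable {X Y Z : PoTop.{u}}

/-- The projection of the cylinder of `X` onto `X`. -/
def proj (X : PoTop.{u}) : X.cylinder ⟶ X :=
  mkHom (fun z : X × Diag unitInterval => z.1) continuous_fst fun _ _ h => h.1

/-- The dimap of cylinders given by a dimap `f` and a reparametrization `a`. -/
def cylMap (f : X ⟶ Y) (a : unitInterval → unitInterval) (ha : Continuous a) :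
    X.cylinder ⟶ Y.cylinder :=
  mkHom (X := X.cylinder) (Y := Y.cylinder)
    (fun z : X × Diag unitInterval => (f z.1, mk (a z.2.get)))
    (by fun_prop) fun _ _ h => ⟨monotone_hom f h.1, congrArg (fun t => mk (a t)) (get_eq_of_le h.2)⟩

/-- Dimaps out of a cylinder from continuous families of dimaps. -/
def cylHom (F : X → unitInterval → Y) (hc : Continuous fun z : X × unitInterval => F z.1 z.2)
    (hm : ∀ t x x', x ≤ x' → F x t ≤ F x' t) : X.cylinder ⟶ Y :=
  mkHom (X := X.cylinder) (fun z : X × Diag unitInterval => F z.1 z.2.get)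
    (hc.comp (f := fun z : X × Diag unitInterval => (z.1, z.2.get)) (by fun_prop))
    fun a b h => by
      rw [get_eq_of_le h.2]
      exact hm _ _ _ h.1

lemma monotone_cylinder (H : X.cylinder ⟶ Y) {x x' : X} (h : x ≤ x') {t t' : unitInterval}
    (ht : t = t') : H (x, mk t) ≤ H (x', mk t') :=
  monotone_hom H (show (x, mk t) ≤ (x', mk t') from ⟨h, ht⟩)

@[fun_prop]
lemma continuous_cylinder {A : Type*} [TopologicalSpace A] (H : X.cylinder ⟶ Y) {f : A → X}
    {t : A → Diag unitInterval} (hf : Continuous f) (ht : Continuous t) :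
    Continuous fun a => H (f a, t a) :=
  (continuous_hom H).comp (hf.prodMk ht)

/-- The first half of the reparametrization in a concatenation. -/
def firstHalf (t : unitInterval) : unitInterval := toI (2 * t)

/-- The second half of the reparametrization in a concatenation. -/
def secondHalf (t : unitInterval) : unitInterval := toI (2 * t - 1)

@[fun_prop]
lemma continuous_firstHalf : Continuous firstHalf := by unfold firstHalf; fun_prop

@[fun_prop]
lemma continuous_secondHalf : Continuous secondHalf := by unfold secondHalf; fun_prop

lemma firstHalf_of_ge {t : unitInterval} (h : (1 / 2 : ℝ) ≤ t) : firstHalf t = 1 :=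
  toI_of_ge (by linarith)

lemma secondHalf_of_le {t : unitInterval} (h : (t : ℝ) ≤ 1 / 2) : secondHalf t = 0 :=
  toI_of_le (by linarith)

@[simp] lemma firstHalf_zero : firstHalf 0 = 0 := toI_of_le (by simp)
@[simp] lemma firstHalf_one : firstHalf 1 = 1 := firstHalf_of_ge (by norm_num)
@[simp] lemma secondHalf_zero : secondHalf 0 = 0 := secondHalf_of_le (by norm_num)
@[simp] lemma secondHalf_one : secondHalf 1 = 1 := toI_of_ge (by norm_num)

/-- The concatenation of two composable dihomotopies. -/
lemma exists_concat (H K : X.cylinder ⟶ Y) (h : ∀ x, H (x, mk 1) = K (x, mk 0)) :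
    ∃ L : X.cylinder ⟶ Y,
      (∀ x (t : unitInterval), (t : ℝ) ≤ 1 / 2 → L (x, mk t) = H (x, mk (firstHalf t))) ∧
      ∀ x (t : unitInterval), (1 / 2 : ℝ) ≤ t → L (x, mk t) = K (x, mk (secondHalf t)) := by
  have key : ∀ x (t : unitInterval), (t : ℝ) = 1 / 2 →
      H (x, mk (firstHalf t)) = K (x, mk (secondHalf t)) := fun x t ht => by
    rw [firstHalf_of_ge ht.ge, secondHalf_of_le ht.le, h]
  refine ⟨cylHom (fun x t => if (t : ℝ) ≤ 1 / 2 then H (x, mk (firstHalf t))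
    else K (x, mk (secondHalf t))) ?_ ?_, ?_, ?_⟩
  · exact Continuous.if_le (by fun_prop) (by fun_prop) (by fun_prop) (by fun_prop)
      fun z hz => key _ _ hz
  · intro t x x' hx
    dsimp only
    split_ifs
    · exact monotone_cylinder H hx rfl
    · exact monotone_cylinder K hx rfl
  · intro x t ht
    exact if_pos ht
  · intro x t ht
    rcases ht.eq_or_lt with ht | ht
    · exact (if_pos ht.ge).trans (key x t ht.symm)
    · exact if_neg ht.not_ge

namespace Dihomotopic

lemma refl (f : X ⟶ Y) : Dihomotopic f f :=
  ⟨X.proj ≫ f, fun _ => ⟨rfl, rfl⟩⟩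

lemma symm {f g : X ⟶ Y} : Dihomotopic f g → Dihomotopic g f := by
  rintro ⟨H, hH⟩
  refine ⟨cylMap (𝟙 X) unitInterval.symm unitInterval.continuous_symm ≫ H,
    fun x => ⟨?_, ?_⟩⟩
  · change H (x, mk (unitInterval.symm 0)) = g x
    rw [unitInterval.symm_zero, (hH x).2]
  · change H (x, mk (unitInterval.symm 1)) = f x
    rw [unitInterval.symm_one, (hH x).1]

lemma trans {f g h : X ⟶ Y} : Dihomotopic f g → Dihomotopic g h → Dihomotopic f h := by
  rintro ⟨H, hH⟩ ⟨K, hK⟩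
  obtain ⟨L, hL, hL'⟩ := exists_concat H K fun x => by rw [(hH x).2, (hK x).1]
  refine ⟨L, fun x => ⟨?_, ?_⟩⟩
  · rw [hL _ _ (by norm_num), firstHalf_zero, (hH x).1]
  · rw [hL' _ _ (by norm_num), secondHalf_one, (hK x).2]

lemma precomp (i : X ⟶ Y) {f g : Y ⟶ Z} : Dihomotopic f g → Dihomotopic (i ≫ f) (i ≫ g) := by
  rintro ⟨H, hH⟩
  exact ⟨cylMap i id continuous_id ≫ H, fun x => hH (i x)⟩

lemma postcomp {f g : X ⟶ Y} (p : Y ⟶ Z) : Dihomotopic f g → Dihomotopic (f ≫ p) (g ≫ p) := by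
  rintro ⟨H, hH⟩
  exact ⟨H ≫ p, fun x => by simp [hH]⟩

end Dihomotopic

end Cylinder

/-! ### The homotopy category and cancellation up to dihomotopy -/

section HomotopyCategory

/-- Dihomotopy, as a relation on the dimaps. -/
def dihomotopyRel : HomRel PoTop.{u} := fun _ _ f g => Dihomotopic f g

instance : Congruence dihomotopyRel.{u} where
  equivalence := ⟨Dihomotopic.refl, Dihomotopic.symm, Dihomotopic.trans⟩
  comp_left f _ _ h := h.precomp f
  comp_right g h := h.postcomp g

/-- Isomorphisms satisfy two-out-of-three and are stable under retracts; both properties pull back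
along a functor. -/
lemma dihomotopyEquivalences_eq : dihomotopyEquivalences.{u} =
    (MorphismProperty.isomorphisms _).inverseImage (Quotient.functor dihomotopyRel) := by
  have key {X : PoTop.{u}} (f : X ⟶ X) : Dihomotopic f (𝟙 X) ↔
      (Quotient.functor dihomotopyRel).map f = 𝟙 _ := by
    rw [← (Quotient.functor dihomotopyRel).map_id, Quotient.functor_map_eq_iff]
    rfl
  ext X Y f
  simp only [MorphismProperty.inverseImage_iff, MorphismProperty.isomorphisms.iff]
  constructor
  · rintro ⟨g, h₁, h₂⟩
    exact ⟨(Quotient.functor dihomotopyRel).map g, by rw [← Functor.map_comp, ← key]; exact h₂,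
      by rw [← Functor.map_comp, ← key]; exact h₁⟩
  · rintro ⟨g, h₁, h₂⟩
    obtain ⟨g, rfl⟩ := (Quotient.functor dihomotopyRel).map_surjective g
    rw [← Functor.map_comp, ← key] at h₁ h₂
    exact ⟨g, h₂, h₁⟩

instance : dihomotopyEquivalences.{u}.HasTwoOutOfThreeProperty := by
  rw [dihomotopyEquivalences_eq]; infer_instance

instance : dihomotopyEquivalences.{u}.IsStableUnderRetracts := by
  rw [dihomotopyEquivalences_eq]; infer_instance

/-- Two one-sided inverses of a dihomotopy equivalence are dihomotopic. -/
lemma dihomotopic_of_comp_eq {X Y Z : PoTop.{u}} {i : X ⟶ Y} (hi : dihomotopyEquivalences i)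
    {f g : Y ⟶ Z} (h : i ≫ f = i ≫ g) : Dihomotopic f g := by
  obtain ⟨r, hr, -⟩ := hi
  have hf := hr.postcomp f
  have hg := hr.postcomp g
  simp only [Category.assoc, Category.id_comp] at hf hg
  rw [h] at hf
  exact hf.symm.trans hg

/-- Compose with a homotopy inverse of `p`. Applied to the projection of an arbitrary cylinder
object, this shows that its two ends are dihomotopic. -/
lemma dihomotopic_of_comp_eq' {X Y Z : PoTop.{u}} {p : Y ⟶ Z} (hp : dihomotopyEquivalences p)
    {f g : X ⟶ Y} (h : f ≫ p = g ≫ p) : Dihomotopic f g := by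
  obtain ⟨s, -, hs⟩ := hp
  have hf := hs.precomp f
  have hg := hs.precomp g
  simp only [← Category.assoc, Category.comp_id] at hf hg
  rw [h] at hf
  exact hf.symm.trans hg

end HomotopyCategory

/-! ### The homotopy lifting property -/

section Lifting

variable {E B : PoTop.{u}}

lemma difibrations_iff (p : E ⟶ B) : difibrations p ↔
    ∀ (Z : PoTop.{u}) (w : Z ⟶ E) (H : Z.cylinder ⟶ B), (∀ z, H (z, mk 0) = p (w z)) →
      ∃ G : Z.cylinder ⟶ E, (∀ z, G (z, mk 0) = w z) ∧ ∀ z, p (G z) = H z := by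
  constructor
  · intro hp Z w H h
    have := hp _ (MorphismProperty.ofHoms.mk (f := fun X : PoTop.{u} => X.incl 0) Z)
    have sq : CommSq w (Z.incl 0) p H := ⟨by ext z; exact (h z).symm⟩
    exact ⟨sq.lift, fun z => ConcreteCategory.congr_hom sq.fac_left z,
      fun z => ConcreteCategory.congr_hom sq.fac_right z⟩
  · intro h _ _ _ hi
    obtain ⟨⟩ := hi
    refine ⟨fun {w H} sq => ?_⟩
    obtain ⟨G, hG, hG'⟩ := h _ w H fun z => (ConcreteCategory.congr_hom sq.w z).symm
    exact ⟨⟨{ l := G, fac_left := by ext z; exact hG z, fac_right := by ext z; exact hG' z }⟩⟩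

/-- The homotopy lifting property of a difibration, evaluated at a variable time: the lift is
unchanged where that time is zero. -/
lemma difibrations.exists_lift_at {Z : PoTop.{u}} {p : E ⟶ B} (hp : difibrations p) (w : Z ⟶ E)
    (H : Z.cylinder ⟶ B) (h : ∀ z, H (z, mk 0) = p (w z)) (φ : Z → unitInterval)
    (hφ : Continuous φ) (hφ' : ∀ z z', z ≤ z' → φ z = φ z') :
    ∃ l : Z ⟶ E, (∀ z, φ z = 0 → l z = w z) ∧ ∀ z, p (l z) = H (z, mk (φ z)) := by
  obtain ⟨G, hG, hG'⟩ := (difibrations_iff p).1 hp Z w H h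
  exact ⟨mkHom (fun z => G (z, mk (φ z))) (by fun_prop)
    fun z z' hz => monotone_cylinder G hz (hφ' z z' hz),
    fun z hz => by simp [hz, hG], fun z => by simp [hG']⟩

end Lifting

/-! ### Limits and colimits of pospaces -/

section Limits

variable {J : Type} [SmallCategory J] (F : J ⥤ PoTop.{u})

/-- The limit of a diagram of pospaces: the compatible families of points. -/
def limitObj : PoTop.{u} :=
  of {s : ∀ j, F.obj j // ∀ {i j : J} (f : i ⟶ j), F.map f (s i) = s j}

/-- The limit cone of a diagram of pospaces. -/
def limitCone : Cone F where
  pt := limitObj F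
  π :=
    { app j := mkHom (X := limitObj F) (fun s => s.1 j)
        ((continuous_apply j).comp continuous_subtype_val) fun _ _ h => h j
      naturality _ _ f := by ext s; exact (s.2 f).symm }

/-- The limit cone is a limit cone. -/
def limitConeIsLimit : IsLimit (limitCone F) where
  lift c := mkHom (Y := limitObj F)
    (fun x => ⟨fun j => c.π.app j x, fun f => ConcreteCategory.congr_hom (c.w f) x⟩)
    (Continuous.subtype_mk (continuous_pi fun j => continuous_hom _) _)
    fun _ _ h j => monotone_hom (c.π.app j) h
  fac _ _ := rfl
  uniq c m h := by
    ext x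
    exact Subtype.ext (funext fun j => ConcreteCategory.congr_hom (h j) x)

/-- The disjoint union of the pospaces of a diagram. -/
def DiagramPoint : Type u := Σ j, F.obj j

instance : TopologicalSpace (DiagramPoint F) :=
  inferInstanceAs (TopologicalSpace (Σ j, F.obj j))

/-- The preorder on the points of a diagram of pospaces induced by all cocones on that diagram. -/
instance : Preorder (DiagramPoint F) where
  le a b := ∀ c : Cocone F, c.ι.app a.1 a.2 ≤ c.ι.app b.1 b.2
  le_refl _ _ := le_rfl
  le_trans _ _ _ h h' c := (h c).trans (h' c)

instance : TopologicalSpace (Antisymmetrization (DiagramPoint F) (· ≤ ·)) :=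
  inferInstanceAs (TopologicalSpace (_root_.Quotient _))

/-- The colimit of a diagram of pospaces: the disjoint union of its points, with the quotient
topology and the finest order for which all cocones are monotone. -/
def colimitObj : PoTop.{u} :=
  of (Antisymmetrization (DiagramPoint F) (· ≤ ·))

/-- The colimit cocone of a diagram of pospaces. -/
def colimitCocone : Cocone F where
  pt := colimitObj F
  ι :=
    { app j := mkHom (Y := colimitObj F) (fun x => toAntisymmetrization (· ≤ ·) ⟨j, x⟩)
        (continuous_quotient_mk'.comp continuous_sigmaMk)
        fun _ _ h c => monotone_hom (c.ι.app j) h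
      naturality i j f := by
        ext x
        have h (c : Cocone F) : c.ι.app j (F.map f x) = c.ι.app i x :=
          ConcreteCategory.congr_hom (c.w f) x
        exact _root_.Quotient.sound ⟨fun c => (h c).le, fun c => (h c).ge⟩ }

/-- The colimit cocone is a colimit cocone. -/
def colimitCoconeIsColimit : IsColimit (colimitCocone F) where
  desc c := mkHom (X := colimitObj F)
    (_root_.Quotient.lift (fun a : DiagramPoint F => c.ι.app a.1 a.2)
      fun _ _ h => le_antisymm (h.1 c) (h.2 c))
    (Continuous.quotient_lift (continuous_sigma fun j => continuous_hom (c.ι.app j)) _)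
    fun a b => _root_.Quotient.inductionOn₂ a b fun _ _ h => h c
  fac _ _ := rfl
  uniq c m h := by
    ext a
    induction a using _root_.Quotient.inductionOn with | _ a => ?_
    exact ConcreteCategory.congr_hom (h a.1) a.2

lemma hasFiniteLimits : HasFiniteLimits PoTop.{u} where
  out _ _ _ := { has_limit := fun F => ⟨⟨⟨limitCone F, limitConeIsLimit F⟩⟩⟩ }

lemma hasFiniteColimits : HasFiniteColimits PoTop.{u} where
  out _ _ _ := { has_colimit := fun F => ⟨⟨⟨colimitCocone F, colimitCoconeIsColimit F⟩⟩⟩ }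

end Limits

/-! ### Path spaces -/

section PathSpace

variable {X Y : PoTop.{u}}

/-- The pospace of paths in `Y`, with the compact-open topology and the pointwise order. -/
abbrev pathSpace (Y : PoTop.{u}) : PoTop.{u} := of C(unitInterval, Y)

/-- Evaluation of paths at the time `t`. -/
def pathEval (Y : PoTop.{u}) (t : unitInterval) : Y.pathSpace ⟶ Y :=
  mkHom (X := Y.pathSpace) (fun γ : C(unitInterval, Y) => γ t) (continuous_eval_const (F := C(unitInterval, Y)) t)
    fun _ _ h => h t

/-- The dimap into the path space given by a continuous family of dimaps. -/
def pathCurry (F : X → unitInterval → Y) (hc : Continuous fun z : X × unitInterval => F z.1 z.2)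
    (hm : ∀ t x x', x ≤ x' → F x t ≤ F x' t) : X ⟶ Y.pathSpace :=
  mkHom (Y := Y.pathSpace)
    (fun x => (⟨F x, hc.comp (continuous_const.prodMk continuous_id)⟩ : C(unitInterval, Y)))
    (ContinuousMap.continuous_of_continuous_uncurry _ hc) fun _ _ h t => hm t _ _ h

/-- The exponential law for the locally compact interval. It turns homotopies on a pushout into
single dimaps out of it, which the universal property can build. -/
lemma dihomotopic_iff_exists_pathSpace {f g : X ⟶ Y} : Dihomotopic f g ↔
    ∃ h : X ⟶ Y.pathSpace, h ≫ Y.pathEval 0 = f ∧ h ≫ Y.pathEval 1 = g := by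
  constructor
  · rintro ⟨H, hH⟩
    refine ⟨pathCurry (fun x t => H (x, mk t)) (by fun_prop)
      fun t _ _ h => monotone_cylinder H h rfl, ?_, ?_⟩
    · ext x; exact (hH x).1
    · ext x; exact (hH x).2
  · rintro ⟨h, rfl, rfl⟩
    exact ⟨cylHom (fun x t => Y.pathEval t (h x))
      (Continuous.eval (F := C(unitInterval, Y)) ((continuous_hom h).comp continuous_fst)
        continuous_snd)
      fun t _ _ hx => monotone_hom h hx t, fun x => ⟨rfl, rfl⟩⟩

/-- The inclusion of the constant paths. -/
def pathConst (Y : PoTop.{u}) : Y ⟶ Y.pathSpace :=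
  pathCurry (fun y _ => y) (by fun_prop) fun _ _ _ h => h

lemma dihomotopyEquivalences_pathConst (Y : PoTop.{u}) :
    dihomotopyEquivalences Y.pathConst := by
  refine ⟨Y.pathEval 0, ?_, Dihomotopic.refl _⟩
  rw [dihomotopic_iff_exists_pathSpace]
  -- The contraction runs through the paths `s ↦ γ (s * t)`.
  let h : Y.pathSpace ⟶ Y.pathSpace.pathSpace :=
    pathCurry (fun γ t => ContinuousMap.comp γ ⟨fun s => s * t, by fun_prop⟩)
      (by
        refine ContinuousMap.continuous_of_continuous_uncurry _ ?_
        change Continuous fun z : (C(unitInterval, Y) × unitInterval) × unitInterval =>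
          z.1.1 (z.2 * z.1.2)
        fun_prop)
      fun t _ _ h s => h _
  refine ⟨h, ?_, ?_⟩
  · ext γ s
    change Y.pathEval (s * 0) γ = Y.pathEval 0 γ
    rw [mul_zero]
  · ext γ s
    change Y.pathEval (s * 1) γ = Y.pathEval s γ
    rw [mul_one]

end PathSpace

/-! ### Moore paths and the factorization through a difibration -/

section Moore

variable {X Y : PoTop.{u}} (f : X ⟶ Y)

/-- A point of the mapping path space of `f`: a point `base` of `X`, with a Moore path in `Y` which
starts at `f base`. -/
structure MoorePath where
  /-- The base point in `X`. -/
  base : X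
  /-- The path in `Y`. -/
  path : C(ℝ≥0, Y)
  /-- The length of the path. -/
  length : ℝ≥0
  source : path 0 = f base
  stable (r : ℝ≥0) : path (min r length) = path r

instance : TopologicalSpace (MoorePath f) :=
  .induced (fun e => (e.base, e.path, e.length)) inferInstance

/-- Lengths are compared by equality so that evaluation at the end point is monotone and times
computed from the length are constant along the order. -/
instance : PartialOrder (MoorePath f) :=
  PartialOrder.lift (fun e => (e.base, e.path, mk e.length)) fun e e' h => by
    obtain ⟨x, γ, t, _, _⟩ := e
    obtain ⟨x', γ', t', _, _⟩ := e'
    simp only [Prod.mk.injEq] at h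
    obtain ⟨rfl, rfl, h⟩ := h
    obtain rfl : t = t' := h
    rfl

/-- The mapping path space of `f` made from Moore paths. Only paths of the same length are
comparable. -/
abbrev mooreSpace : PoTop.{u} := of (MoorePath f)

variable {f} in
/-- Dimaps into the mapping path space. -/
def mooreLift {Z : PoTop.{u}} (x : Z → X) (γ : Z → ℝ≥0 → Y) (t : Z → ℝ≥0)
    (hx : Continuous x) (hx' : ∀ z z', z ≤ z' → x z ≤ x z')
    (hγ : Continuous fun z : Z × ℝ≥0 => γ z.1 z.2)
    (hγ' : ∀ z z', z ≤ z' → ∀ r, γ z r ≤ γ z' r)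
    (ht : Continuous t) (ht' : ∀ z z', z ≤ z' → t z = t z')
    (h₀ : ∀ z, γ z 0 = f (x z)) (h₁ : ∀ z r, γ z (min r (t z)) = γ z r) :
    Z ⟶ mooreSpace f :=
  mkHom (Y := mooreSpace f)
    (fun z => ⟨x z, ⟨γ z, hγ.comp (continuous_const.prodMk continuous_id)⟩, t z, h₀ z, h₁ z⟩)
    (continuous_induced_rng.2 (hx.prodMk
      ((ContinuousMap.continuous_of_continuous_uncurry _ hγ).prodMk ht)))
    fun _ _ h => ⟨hx' _ _ h, fun r => hγ' _ _ h r, ht' _ _ h⟩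

namespace MoorePath

variable {f}

lemma ext' {e e' : MoorePath f} (h₁ : e.base = e'.base) (h₂ : ∀ r, e.path r = e'.path r)
    (h₃ : e.length = e'.length) : e = e' := by
  obtain ⟨x, γ, t, _, _⟩ := e
  obtain ⟨x', γ', t', _, _⟩ := e'
  obtain rfl : γ = γ' := ContinuousMap.ext h₂
  obtain rfl : x = x' := h₁
  obtain rfl : t = t' := h₃
  rfl

lemma continuous_data : Continuous fun e : MoorePath f => (e.base, e.path, e.length) :=
  continuous_induced_dom

@[fun_prop]
lemma continuous_base : Continuous (base : MoorePath f → X) :=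
  continuous_fst.comp continuous_data

@[fun_prop]
lemma continuous_length : Continuous (length : MoorePath f → ℝ≥0) :=
  continuous_snd.comp (continuous_snd.comp continuous_data)

@[fun_prop]
lemma continuous_path {A : Type*} [TopologicalSpace A] {e : A → MoorePath f} {r : A → ℝ≥0}
    (he : Continuous e) (hr : Continuous r) : Continuous fun a => (e a).path (r a) :=
  Continuous.eval (continuous_fst.comp (continuous_snd.comp (continuous_data.comp he))) hr

lemma base_mono {e e' : MoorePath f} (h : e ≤ e') : e.base ≤ e'.base := h.1

lemma path_mono {e e' : MoorePath f} (h : e ≤ e') (r : ℝ≥0) : e.path r ≤ e'.path r := h.2.1 r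

lemma length_eq_of_le {e e' : MoorePath f} (h : e ≤ e') : e.length = e'.length := h.2.2

end MoorePath

namespace mooreSpace

open MoorePath

/-- The inclusion of `X` in the mapping path space, by paths of length zero. -/
def const : X ⟶ mooreSpace f :=
  mooreLift id (fun x _ => f x) (fun _ => 0) continuous_id (fun _ _ h => h) (by fun_prop)
    (fun _ _ h _ => monotone_hom f h) continuous_const (fun _ _ _ => rfl) (fun _ => rfl)
    fun _ _ => rfl

/-- The projection of the mapping path space to `X`. -/
def baseHom : mooreSpace f ⟶ X := mkHom (X := mooreSpace f) base continuous_base fun _ _ h => h.1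

/-- The end point of a path. -/
def target : mooreSpace f ⟶ Y :=
  mkHom (X := mooreSpace f) (fun e : MoorePath f => e.path e.length) (by fun_prop) fun e e' h => by
    rw [length_eq_of_le h]
    exact path_mono h _

lemma const_target : const f ≫ target f = f := rfl

/-- Truncation of the Moore paths at the time `s * (1 + t)`, where `t` is the length. -/
def truncate : (mooreSpace f).cylinder ⟶ mooreSpace f :=
  mooreLift (Z := (mooreSpace f).cylinder) (fun z => z.1.base)
    -- The factor `1 + t` instead of `t` lets the truncation already be the whole path at `s = t /
    -- (1 + t)`, a time depending continuously on `t` and vanishing at `t = 0`.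
    (fun z r => z.1.path (min r (unitInterval.toNNReal z.2.get * (1 + z.1.length))))
    (fun z => min z.1.length (unitInterval.toNNReal z.2.get * (1 + z.1.length)))
    (continuous_base.comp continuous_fst)
    (fun _ _ h => base_mono h.1)
    (by
      change Continuous fun z : (mooreSpace f × Diag unitInterval) × ℝ≥0 =>
        z.1.1.path (min z.2 (unitInterval.toNNReal z.1.2.get * (1 + z.1.1.length)))
      fun_prop)
    (fun z z' h r => by
      rw [length_eq_of_le h.1, get_eq_of_le h.2]
      exact path_mono h.1 _)
    (by
      change Continuous fun z : mooreSpace f × Diag unitInterval =>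
        min z.1.length (unitInterval.toNNReal z.2.get * (1 + z.1.length))
      fun_prop)
    (fun z z' h => by rw [length_eq_of_le h.1, get_eq_of_le h.2])
    (fun z => by rw [min_eq_left (zero_le), source])
    (fun z r => by
      rw [← stable _ (min r _)]
      conv_rhs => rw [← stable]
      congr 1
      grind)

lemma truncate_eq_self (e : MoorePath f) (s : unitInterval)
    (h : e.length ≤ unitInterval.toNNReal s * (1 + e.length)) : truncate f (e, mk s) = e := by
  refine ext' rfl (fun r => ?_) (min_eq_left h)
  change e.path (min r (unitInterval.toNNReal s * (1 + e.length))) = e.path r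
  rw [← stable, min_assoc, min_eq_right h, stable]

lemma truncate_zero (e : MoorePath f) : truncate f (e, mk 0) = const f e.base := by
  have h : unitInterval.toNNReal 0 * (1 + e.length) = 0 := by simp
  refine ext' rfl (fun r => ?_) ?_
  · change e.path (min r (unitInterval.toNNReal 0 * (1 + e.length))) = f e.base
    rw [h, min_eq_right (zero_le), source]
  · change min e.length (unitInterval.toNNReal 0 * (1 + e.length)) = 0
    rw [h, min_eq_right (zero_le)]

lemma dihomotopyEquivalences_const : dihomotopyEquivalences (const f) :=
  ⟨baseHom f, ⟨truncate f, fun e => ⟨truncate_zero f e, truncate_eq_self f e 1 (by simp)⟩⟩,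
    Dihomotopic.refl _⟩

/-- Lift the truncation homotopy, starting from `u` on base points, and stop at time `length / (1 +
length)`. The truncation is then complete, so the lift lies over `v`; on paths of length zero no
time has passed, so it restricts to `u`. -/
lemma const_mem_llp : difibrations.llp (const f) := by
  intro E B p hp
  refine ⟨fun {u v} sq => ?_⟩
  have hφ (e : MoorePath f) : e.length / (1 + e.length) ≤ 1 :=
    div_le_one_of_le₀ (by simp) (by simp)
  obtain ⟨l, hl, hl'⟩ := difibrations.exists_lift_at hp (baseHom f ≫ u) (truncate f ≫ v)
    (fun e => (congrArg v (truncate_zero f e)).trans (ConcreteCategory.congr_hom sq.w e.base).symm)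
    (fun e => ⟨(e.length / (1 + e.length) : ℝ≥0), NNReal.coe_nonneg _, hφ e⟩)
    (Continuous.subtype_mk (NNReal.continuous_coe.comp
      (continuous_length.div (by fun_prop) fun e => by positivity)) _)
    fun e e' h => by simp only [length_eq_of_le h]
  refine ⟨⟨{ l := l, fac_left := ?_, fac_right := ?_ }⟩⟩
  · ext x
    refine hl (const f x) (Subtype.ext ?_)
    change (((0 : ℝ≥0) / (1 + 0) : ℝ≥0) : ℝ) = 0
    simp
  · ext e
    refine (hl' e).trans (congrArg v (truncate_eq_self f e _ ?_))
    have : unitInterval.toNNReal ⟨(e.length / (1 + e.length) : ℝ≥0), NNReal.coe_nonneg _, hφ e⟩ =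
      e.length / (1 + e.length) := rfl
    rw [this, div_mul_cancel₀ _ (by positivity)]

section Extend

variable {f} {Z : PoTop.{u}} (w : Z ⟶ mooreSpace f) (H : Z.cylinder ⟶ Y)

/-- The concatenation of a Moore path with a path given by a homotopy, followed up to time `s`. -/
def extendPath (z : Z) (s : unitInterval) (r : ℝ≥0) : Y :=
  if r ≤ (w z).length then (w z).path r
  else H (z, mk (min (toI ((r - (w z).length : ℝ≥0) : ℝ)) s))

variable {w H}

lemma extendPath_of_ge (h : ∀ z, H (z, mk 0) = target f (w z)) {z : Z} (s : unitInterval) {r : ℝ≥0} (hr : (w z).length ≤ r) :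
    extendPath w H z s r = H (z, mk (min (toI ((r - (w z).length : ℝ≥0) : ℝ)) s)) := by
  rcases hr.eq_or_lt with rfl | hr
  · rw [extendPath, if_pos le_rfl, tsub_self, NNReal.coe_zero, toI_of_le le_rfl,
      min_eq_left unitInterval.nonneg', h]
    rfl
  · rw [extendPath, if_neg hr.not_ge]

lemma continuous_extendPath (h : ∀ z, H (z, mk 0) = target f (w z)) :
    Continuous fun a : (Z × unitInterval) × ℝ≥0 => extendPath w H a.1.1 a.1.2 a.2 := by
  refine Continuous.if_le (by fun_prop) (by fun_prop) (by fun_prop) (by fun_prop) fun a ha => ?_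
  rw [← extendPath_of_ge h _ ha.ge, extendPath, if_pos ha.le]

end Extend

/-- At time `s`, append to the path of `w z` the part of `H (z, ·)` up to `s`, adding `s` to the
length. At `s = 0` this is the original path, with no reparametrization to undo. -/
lemma difibrations_target : difibrations (target f) := by
  rw [difibrations_iff]
  intro Z w H h
  have hw : Continuous fun z => w z := continuous_hom w
  let G : Z.cylinder ⟶ mooreSpace f :=
    mooreLift (Z := Z.cylinder) (fun z => (w z.1).base)
      (fun z r => extendPath w H z.1 z.2.get r)
      (fun z => (w z.1).length + unitInterval.toNNReal z.2.get)
      (continuous_base.comp (hw.comp continuous_fst))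
      (fun _ _ h => base_mono (monotone_hom w h.1))
      ((continuous_extendPath h).comp
        (f := fun a : (Z × Diag unitInterval) × ℝ≥0 => ((a.1.1, a.1.2.get), a.2)) (by fun_prop))
      (fun z z' hz r => by
        have := length_eq_of_le (monotone_hom w hz.1)
        unfold extendPath
        rw [this, get_eq_of_le hz.2]
        split_ifs
        · exact path_mono (monotone_hom w hz.1) _
        · exact monotone_cylinder H hz.1 rfl)
      (by
        change Continuous fun z : Z × Diag unitInterval =>
          (w z.1).length + unitInterval.toNNReal z.2.get
        fun_prop)
      (fun z z' hz => by rw [length_eq_of_le (monotone_hom w hz.1), get_eq_of_le hz.2])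
      (fun z => by rw [extendPath, if_pos (zero_le), source])
      (fun z r => by
        -- Past the new length the clock of the appended part stays at `s`.
        rcases le_total r ((w z.1).length + unitInterval.toNNReal z.2.get) with hr | hr
        · rw [min_eq_left hr]
        · rw [min_eq_right hr, extendPath_of_ge h _ le_self_add,
            extendPath_of_ge h _ (le_self_add.trans hr), add_tsub_cancel_left,
            unitInterval.coe_toNNReal, toI_coe, min_self, min_eq_right]
          rw [← toI_coe z.2.get]
          refine Set.monotone_projIcc _ ?_
          exact_mod_cast (le_tsub_of_add_le_left hr :
            unitInterval.toNNReal z.2.get ≤ r - (w z.1).length))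
  refine ⟨G, fun z => ?_, fun z => ?_⟩
  · refine ext' rfl (fun r => ?_) ?_
    · change extendPath w H z 0 r = (w z).path r
      rcases le_total r (w z).length with hr | hr
      · rw [extendPath, if_pos hr]
      · rw [extendPath_of_ge h _ hr, min_eq_right unitInterval.nonneg', h,
          ← (w z).stable, min_eq_right hr]
        rfl
    · change (w z).length + unitInterval.toNNReal 0 = (w z).length
      simp
  · change extendPath w H z.1 z.2.get ((w z.1).length + unitInterval.toNNReal z.2.get) = H z
    rw [extendPath_of_ge h _ le_self_add, add_tsub_cancel_left]
    rw [unitInterval.coe_toNNReal, toI_coe, min_self]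
    rfl

end mooreSpace

end Moore

/-! ### Trivial difibrations -/

section TrivialDifibration

variable {E B : PoTop.{u}}

/-- A difibration which is a dihomotopy equivalence has a section, which is a dihomotopy inverse
over the base. -/
lemma exists_section_of_trivial {p : E ⟶ B} (hp : difibrations p)
    (hw : dihomotopyEquivalences p) :
    ∃ (s : B ⟶ E) (K : E.cylinder ⟶ E), (∀ b, p (s b) = b) ∧ (∀ e, K (e, mk 0) = e) ∧
      (∀ e, K (e, mk 1) = s (p e)) ∧ ∀ e t, p (K (e, mk t)) = p e := by
  obtain ⟨g, ⟨H, hH⟩, hg⟩ := hw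
  -- Lifting the homotopy from `g ≫ p` to the identity moves `g` to a strict section.
  obtain ⟨G, hG, hG'⟩ := (difibrations_iff p).1 hp B g H fun b => (hH b).1
  let s : B ⟶ E := B.incl 1 ≫ G
  have hs (b : B) : p (s b) = b := (hG' _).trans (hH b).2
  have hgs : Dihomotopic g s := ⟨G, fun b => ⟨hG b, rfl⟩⟩
  obtain ⟨L, hL⟩ := hg.symm.trans (hgs.precomp p)
  have hL₀ (e : E) : L (e, mk 0) = e := (hL e).1
  have hL₁ (e : E) : L (e, mk 1) = s (p e) := (hL e).2
  have hK (e : E) (t : unitInterval) : (cylMap (𝟙 E) unitInterval.symm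
      unitInterval.continuous_symm ≫ L ≫ p ≫ s) (e, mk t) =
        s (p (L (e, mk (unitInterval.symm t)))) := rfl
  -- `L` need not stay in the fibres. Following it by the reverse of its image under `p ≫ s` gives a
  -- homotopy `W` with the same ends, whose projection runs along `p ∘ L` and back.
  obtain ⟨W, hW, hW'⟩ := exists_concat L
    (cylMap (𝟙 E) unitInterval.symm unitInterval.continuous_symm ≫ L ≫ p ≫ s) fun e => by
      rw [hK, unitInterval.symm_zero, hL₁, hs]
  let τ (t : unitInterval) : unitInterval := min (firstHalf t) (unitInterval.symm (secondHalf t))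
  have hτ : Continuous τ := by fun_prop
  have hpW (e : E) (t : unitInterval) : p (W (e, mk t)) = p (L (e, mk (τ t))) := by
    rcases le_total (t : ℝ) (1 / 2) with ht | ht
    · rw [hW e t ht]
      simp only [τ, secondHalf_of_le ht, unitInterval.symm_zero,
        min_eq_left unitInterval.le_one']
    · rw [hW' e t ht, hK, hs]
      simp only [τ, firstHalf_of_ge ht, min_eq_right unitInterval.le_one']
  -- Contract this back-and-forth path by lowering the time `τ` of `p ∘ L` to zero, and lift the
  -- contraction from `W`. Stopping at `s = τ t` puts the result in the fibre; the ends are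
  -- unchanged because `τ` vanishes there.
  obtain ⟨K, hK₀, hK₁⟩ := difibrations.exists_lift_at hp W
    (cylHom (X := E.cylinder) (fun z s => p (L (z.1, mk (toI (τ z.2.get - s)))))
      (by
        change Continuous fun z : (E × Diag unitInterval) × unitInterval =>
          p (L (z.1.1, mk (toI (τ z.1.2.get - z.2))))
        fun_prop)
      fun t z z' h => by
        rw [get_eq_of_le h.2]
        exact monotone_hom p (monotone_cylinder L h.1 rfl))
    (fun z => by
      change p (L (z.1, mk (toI (τ z.2.get - (0 : ℝ))))) = p (W z)
      rw [sub_zero, toI_coe]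
      exact (hpW z.1 z.2.get).symm)
    (fun z => τ z.2.get) (hτ.comp (continuous_get.comp continuous_snd))
    fun z z' h => by rw [get_eq_of_le h.2]
  refine ⟨s, K, hs, fun e => ?_, fun e => ?_, fun e t => ?_⟩
  · rw [hK₀ (e, mk 0) (by simp [τ]), hW _ _ (by norm_num), firstHalf_zero, hL₀]
  · rw [hK₀ (e, mk 1) (by simp [τ]), hW' _ _ (by norm_num), secondHalf_one, hK,
      unitInterval.symm_one, hL₀]
  · refine (hK₁ (e, mk t)).trans ?_
    change p (L (e, mk (toI (τ t - τ t)))) = p e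
    rw [sub_self, toI_of_le le_rfl, hL₀]

/-- A homotopy in the base of a trivial difibration lifts with prescribed ends. -/
lemma exists_lift_of_ends {p : E ⟶ B} (hp : difibrations p) (hw : dihomotopyEquivalences p)
    {X : PoTop.{u}} (u₀ u₁ : X ⟶ E) (v : X.cylinder ⟶ B) (h₀ : ∀ x, v (x, mk 0) = p (u₀ x))
    (h₁ : ∀ x, v (x, mk 1) = p (u₁ x)) :
    ∃ w : X.cylinder ⟶ E, (∀ x, w (x, mk 0) = u₀ x) ∧ (∀ x, w (x, mk 1) = u₁ x) ∧
      ∀ z, p (w z) = v z := by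
  obtain ⟨s, K, hs, hK₀, hK₁, hK⟩ := exists_section_of_trivial hp hw
  have hA (x : X) (t : unitInterval) : (cylMap u₀ id continuous_id ≫ K) (x, mk t) =
    K (u₀ x, mk t) := rfl
  have hC (x : X) (t : unitInterval) :
    (cylMap u₁ unitInterval.symm unitInterval.continuous_symm ≫ K) (x, mk t) =
      K (u₁ x, mk (unitInterval.symm t)) := rfl
  have hS (z : X.cylinder) : (v ≫ s) z = s (v z) := rfl
  -- Push `u₀` into the section along `K`, follow `s ∘ v`, and return to `u₁` along the reverse of
  -- `K`. This has the right ends, but lies over `v` reparametrized by `ρ`.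
  obtain ⟨M, hM, hM'⟩ := exists_concat (v ≫ s)
    (cylMap u₁ unitInterval.symm unitInterval.continuous_symm ≫ K) fun x => by
      rw [hC, unitInterval.symm_zero, hK₁, hS, h₁]
  have hM₀ (x : X) : M (x, mk 0) = s (p (u₀ x)) := by
    rw [hM _ _ (by norm_num), firstHalf_zero, hS, h₀]
  obtain ⟨W, hW, hW'⟩ := exists_concat (cylMap u₀ id continuous_id ≫ K) M fun x => by
    rw [hA, hK₁, hM₀]
  let ρ (t : unitInterval) : unitInterval := firstHalf (secondHalf t)
  have hρ : Continuous ρ := by fun_prop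
  have hpM (x : X) (t : unitInterval) : p (M (x, mk t)) = v (x, mk (firstHalf t)) := by
    rcases le_total (t : ℝ) (1 / 2) with ht | ht
    · rw [hM x t ht, hS, hs]
    · rw [hM' x t ht, hC, hK, firstHalf_of_ge ht, h₁]
  have hpW (x : X) (t : unitInterval) : p (W (x, mk t)) = v (x, mk (ρ t)) := by
    rcases le_total (t : ℝ) (1 / 2) with ht | ht
    · rw [hW x t ht, hA, hK]
      simp only [ρ, secondHalf_of_le ht, firstHalf_zero, h₀]
    · rw [hW' x t ht, hpM]
  -- `μ t` moves from `ρ t` towards `t` at unit speed, the displacement being `t - ρ t` clamped to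
  -- `[-s, s]`. It arrives at time `φ t`, which is zero at both ends, so correcting `ρ` leaves the
  -- ends fixed.
  let μ (t s : unitInterval) : unitInterval := toI (ρ t + max (-(s : ℝ)) (min s (t - ρ t)))
  let φ (t : unitInterval) : unitInterval := toI |(t : ℝ) - ρ t|
  have hφ (t : unitInterval) : (φ t : ℝ) = |(t : ℝ) - ρ t| := by
    refine coe_toI (abs_nonneg _) (abs_le.2 ⟨?_, ?_⟩)
    · linarith [t.2.1, (ρ t).2.2]
    · linarith [t.2.2, (ρ t).2.1]
  have hμ₀ (t : unitInterval) : μ t 0 = ρ t := by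
    have : max (-0 : ℝ) (min 0 (t - ρ t)) = 0 := by
      rw [neg_zero]
      exact max_eq_left (min_le_left _ _)
    simp only [μ, Set.Icc.coe_zero, this, add_zero, toI_coe]
  have hμφ (t : unitInterval) : μ t (φ t) = t := by
    simp only [μ, hφ]
    rw [min_eq_right (le_abs_self _), max_eq_right (neg_abs_le _), add_sub_cancel, toI_coe]
  obtain ⟨w, hw₀, hw₁⟩ := difibrations.exists_lift_at hp W
    (cylHom (X := X.cylinder) (fun z s => v (z.1, mk (μ z.2.get s)))
      (by
        change Continuous fun z : (X × Diag unitInterval) × unitInterval =>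
          v (z.1.1, mk (μ z.1.2.get z.2))
        fun_prop)
      fun t z z' h => monotone_cylinder v h.1 (by rw [get_eq_of_le h.2]))
    (fun z => by
      change v (z.1, mk (μ z.2.get 0)) = p (W z)
      rw [hμ₀]
      exact (hpW z.1 z.2.get).symm)
    (fun z => φ z.2.get)
    (by
      change Continuous fun z : X × Diag unitInterval => φ z.2.get
      fun_prop)
    fun z z' h => by rw [get_eq_of_le h.2]
  refine ⟨w, fun x => ?_, fun x => ?_, fun z => ?_⟩
  · rw [hw₀ (x, mk 0) (by simp [φ, ρ, toI_of_le]), hW _ _ (by norm_num), firstHalf_zero, hA, hK₀]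
  · rw [hw₀ (x, mk 1) (by simp [φ, ρ, toI_of_le]), hW' _ _ (by norm_num), secondHalf_one,
      hM' _ _ (by norm_num), secondHalf_one, hC, unitInterval.symm_one, hK₀]
  · refine (hw₁ z).trans ?_
    change v (z.1, mk (μ z.2.get (φ z.2.get))) = v z
    rw [hμφ]
    rfl

end TrivialDifibration

/-! ### Mapping cylinders and the two factorizations -/

section Factorization

variable {X Y : PoTop.{u}} (f : X ⟶ Y)

attribute [local instance] hasFiniteColimits

/-- The mapping cylinder of a dimap. -/
abbrev mappingCylinder : PoTop.{u} := pushout (X.incl 0) f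

namespace mappingCylinder

/-- The inclusion of the source at the free end of the mapping cylinder. -/
def source : X ⟶ mappingCylinder f := X.incl 1 ≫ pushout.inl (X.incl 0) f

/-- The inclusion of the target in the mapping cylinder. -/
def target : Y ⟶ mappingCylinder f := pushout.inr (X.incl 0) f

/-- The retraction of the mapping cylinder onto the target. -/
def retraction : mappingCylinder f ⟶ Y := pushout.desc (X.proj ≫ f) (𝟙 Y) (by ext; rfl)

lemma source_retraction : source f ≫ retraction f = f := by
  rw [source, retraction, Category.assoc, pushout.inl_desc]
  rfl

lemma target_retraction : target f ≫ retraction f = 𝟙 Y := pushout.inr_desc _ _ _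

lemma dihomotopyEquivalences_target : dihomotopyEquivalences (target f) := by
  refine ⟨retraction f, ?_, by rw [target_retraction]; exact Dihomotopic.refl _⟩
  have w (x : X) : pushout.inl (X.incl 0) f (x, mk 0) = pushout.inr (X.incl 0) f (f x) :=
    ConcreteCategory.congr_hom (pushout.condition (f := X.incl 0) (g := f)) x
  let h₁ : X.cylinder ⟶ (mappingCylinder f).pathSpace :=
    pathCurry (fun z t => pushout.inl (X.incl 0) f (z.1, mk (z.2.get * t)))
      (by
        change Continuous fun z : (X × Diag unitInterval) × unitInterval =>
          pushout.inl (X.incl 0) f (z.1.1, mk (z.1.2.get * z.2))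
        fun_prop)
      fun t _ _ h => monotone_cylinder _ h.1 (by rw [get_eq_of_le h.2])
  let h : mappingCylinder f ⟶ (mappingCylinder f).pathSpace :=
    pushout.desc h₁ (target f ≫ pathConst _) (by
      ext x t
      change pushout.inl (X.incl 0) f (x, mk (0 * t)) = pushout.inr (X.incl 0) f (f x)
      rw [zero_mul, w])
  rw [dihomotopic_iff_exists_pathSpace]
  refine ⟨h, pushout.hom_ext ?_ ?_, pushout.hom_ext ?_ ?_⟩
  · rw [retraction, pushout.inl_desc_assoc, pushout.inl_desc_assoc]
    ext z
    change pushout.inl (X.incl 0) f (z.1, mk (z.2.get * 0)) = pushout.inr (X.incl 0) f (f z.1)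
    rw [mul_zero, w]
  · rw [retraction, pushout.inr_desc_assoc, pushout.inr_desc_assoc]
    rfl
  · rw [pushout.inl_desc_assoc, Category.comp_id]
    ext z
    change pushout.inl (X.incl 0) f (z.1, mk (z.2.get * 1)) = pushout.inl (X.incl 0) f z
    rw [mul_one]
    rfl
  · rw [pushout.inr_desc_assoc, Category.comp_id]
    rfl

lemma dihomotopyEquivalences_retraction : dihomotopyEquivalences (retraction f) := by
  refine MorphismProperty.of_precomp _ (target f) (retraction f)
    (dihomotopyEquivalences_target f) ?_
  rw [target_retraction]
  exact ⟨𝟙 Y, Dihomotopic.refl _, Dihomotopic.refl _⟩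

/-- A section of `p` gives a lift on the target `Y`. On the cylinder it remains to lift a homotopy
whose ends are prescribed by this lift and by `u`. -/
lemma dicofibrations_source : dicofibrations (source f) := by
  intro E B p hp
  refine ⟨fun {u v} sq => ?_⟩
  obtain ⟨s, -, hs, -⟩ := exists_section_of_trivial hp.1 hp.2
  have w : X.incl 0 ≫ pushout.inl (X.incl 0) f = f ≫ pushout.inr (X.incl 0) f :=
    pushout.condition
  obtain ⟨l, hl₀, hl₁, hl⟩ := exists_lift_of_ends hp.1 hp.2 (f ≫ target f ≫ v ≫ s) u
    (pushout.inl (X.incl 0) f ≫ v)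
    (fun x => (congrArg v (ConcreteCategory.congr_hom w x)).trans (hs _).symm)
    (fun x => (ConcreteCategory.congr_hom sq.w x).symm)
  refine ⟨⟨{ l := pushout.desc l (target f ≫ v ≫ s) (ConcreteCategory.hom_ext _ _ hl₀)
             fac_left := ?_, fac_right := pushout.hom_ext ?_ ?_ }⟩⟩
  · rw [source, Category.assoc, pushout.inl_desc]
    ext x
    exact hl₁ x
  · rw [pushout.inl_desc_assoc]
    ext z
    exact hl z
  · rw [pushout.inr_desc_assoc]
    ext y
    exact hs _

end mappingCylinder

lemma llp_difibrations_le_dicofibrations : difibrations.llp ≤ dicofibrations.{u} :=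
  MorphismProperty.antitone_llp inf_le_left

instance : MorphismProperty.HasFactorization
    (difibrations.llp ⊓ dihomotopyEquivalences) difibrations.{u} where
  nonempty_mapFactorizationData f :=
    ⟨{ Z := mooreSpace f
       i := mooreSpace.const f
       p := mooreSpace.target f
       fac := mooreSpace.const_target f
       hi := ⟨mooreSpace.const_mem_llp f, mooreSpace.dihomotopyEquivalences_const f⟩
       hp := mooreSpace.difibrations_target f }⟩

instance : MorphismProperty.HasFactorization
    dicofibrations.{u} (difibrations ⊓ dihomotopyEquivalences) where
  nonempty_mapFactorizationData f := by
    let r := mappingCylinder.retraction f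
    refine ⟨{ Z := mooreSpace r
              i := mappingCylinder.source f ≫ mooreSpace.const r
              p := mooreSpace.target r
              fac := ?_, hi := ?_, hp := ⟨mooreSpace.difibrations_target r, ?_⟩ }⟩
    · rw [Category.assoc, mooreSpace.const_target, mappingCylinder.source_retraction]
    · exact MorphismProperty.comp_mem (MorphismProperty.llp _) _ _ (mappingCylinder.dicofibrations_source f)
        (llp_difibrations_le_dicofibrations _ (mooreSpace.const_mem_llp r))
    · refine MorphismProperty.of_precomp _ (mooreSpace.const r) _
        (mooreSpace.dihomotopyEquivalences_const r) ?_
      rw [mooreSpace.const_target]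
      exact mappingCylinder.dihomotopyEquivalences_retraction f

/-- The dicofibrations which are dihomotopy equivalences are the dimaps with the left lifting
property against all difibrations. -/
lemma trivial_dicofibrations_le : dicofibrations ⊓ dihomotopyEquivalences.{u} ≤
    difibrations.llp := by
  intro A B i hi
  have d := MorphismProperty.factorizationData (difibrations.llp ⊓ dihomotopyEquivalences)
    difibrations.{u} i
  have hp : dihomotopyEquivalences d.p :=
    MorphismProperty.of_precomp _ d.i d.p d.hi.2 (by rw [d.fac]; exact hi.2)
  have := hi.1 d.p ⟨d.hp, hp⟩
  -- Lifting `i` against `d.p` exhibits `i` as a retract of `d.i`.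
  exact MorphismProperty.of_retract (RetractArrow.ofLeftLiftingProperty d.fac) d.hi.1

end Factorization

/-! ### The model structure and its homotopy relations -/

section ModelCategory

/-- The model category of pospaces. -/
abbrev modelCategory : ModelCategory PoTop.{u} where
  categoryWithFibrations := ⟨difibrations⟩
  categoryWithCofibrations := ⟨dicofibrations⟩
  categoryWithWeakEquivalences := ⟨dihomotopyEquivalences⟩
  cm1a := hasFiniteLimits
  cm1b := hasFiniteColimits
  cm2 := (inferInstance : dihomotopyEquivalences.HasTwoOutOfThreeProperty)
  cm3a := (inferInstance : dihomotopyEquivalences.IsStableUnderRetracts)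
  cm3b := by
    change difibrations.IsStableUnderRetracts
    exact MorphismProperty.rlp_isStableUnderRetracts _
  cm3c := by
    change dicofibrations.IsStableUnderRetracts
    exact MorphismProperty.llp_isStableUnderRetracts _
  cm4a i p hi hi' hp := trivial_dicofibrations_le i ⟨hi.mem, hi'.mem⟩ p hp.mem
  cm4b i p hi hp hp' := hi.mem p ⟨hp.mem, hp'.mem⟩
  cm5a := ⟨fun f => by
    have d := MorphismProperty.factorizationData (difibrations.llp ⊓ dihomotopyEquivalences)
      difibrations.{u} f
    exact ⟨⟨d.Z, d.i, d.p, d.fac, ⟨llp_difibrations_le_dicofibrations _ d.hi.1, d.hi.2⟩, d.hp⟩⟩⟩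
  cm5b := (inferInstance : MorphismProperty.HasFactorization
    dicofibrations.{u} (difibrations ⊓ dihomotopyEquivalences))

attribute [local instance] modelCategory

lemma isFibrant_of_pospace (X : PoTop.{u}) : IsFibrant X := by
  rw [isFibrant_iff, fibration_iff]
  refine (difibrations_iff _).2 fun Z w H h => ⟨Z.proj ≫ w, fun _ => rfl, fun z => ?_⟩
  exact ConcreteCategory.congr_hom
    (terminalIsTerminal.hom_ext ((Z.proj ≫ w) ≫ terminal.from X) H) z

/-- Trivial difibrations have sections. -/
lemma isCofibrant_of_pospace (X : PoTop.{u}) : IsCofibrant X := by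
  rw [isCofibrant_iff, cofibration_iff]
  intro E B p hp
  refine ⟨fun {u v} sq => ?_⟩
  obtain ⟨s, -, hs, -⟩ := exists_section_of_trivial hp.1 hp.2
  exact ⟨⟨v ≫ s, initialIsInitial.hom_ext _ _, by ext x; exact hs _⟩⟩

variable {X Y : PoTop.{u}} (f g : X ⟶ Y)

/-- The ends of any cylinder object are sections of one weak equivalence, hence dihomotopic.
Conversely `X.cylinder` is itself a cylinder object. -/
lemma leftHomotopyRel_iff : LeftHomotopyRel f g ↔ Dihomotopic f g := by
  constructor
  · rintro ⟨P, ⟨h⟩⟩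
    have := dihomotopic_of_comp_eq' P.weakEquivalence_π.mem (P.i₀_π.trans P.i₁_π.symm)
    simpa only [h.h₀, h.h₁] using this.postcomp h.h
  · rintro ⟨H, hH⟩
    have hπ : dihomotopyEquivalences X.proj := by
      refine ⟨X.incl 0, Dihomotopic.refl _, ?_⟩
      refine ⟨cylHom (X := X.cylinder) (Y := X.cylinder) (fun z s => (z.1, mk (z.2.get * s)))
        ?_ fun t _ _ h => ⟨h.1, ?_⟩, fun z => ⟨?_, ?_⟩⟩
      · change Continuous fun z : (X × Diag unitInterval) × unitInterval =>
          (z.1.1, mk (z.1.2.get * z.2))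
        fun_prop
      · rw [get_eq_of_le h.2]
      · change (z.1, mk (z.2.get * 0)) = (z.1, mk 0)
        rw [mul_zero]
      · change (z.1, mk (z.2.get * 1)) = z
        rw [mul_one]
        rfl
    exact ⟨{ I := X.cylinder, i₀ := X.incl 0, i₁ := X.incl 1, π := X.proj
             i₀_π := rfl, i₁_π := rfl, weakEquivalence_π := ⟨hπ⟩ },
      ⟨{ h := H, h₀ := by ext x; exact (hH x).1, h₁ := by ext x; exact (hH x).2 }⟩⟩

lemma rightHomotopyRel_iff : RightHomotopyRel f g ↔ Dihomotopic f g := by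
  constructor
  · rintro ⟨P, ⟨h⟩⟩
    have := dihomotopic_of_comp_eq P.weakEquivalence_ι.mem (P.ι_p₀.trans P.ι_p₁.symm)
    simpa only [h.h₀, h.h₁] using this.precomp h.h
  · rw [dihomotopic_iff_exists_pathSpace]
    rintro ⟨h, h₀, h₁⟩
    exact ⟨{ P := Y.pathSpace, p₀ := Y.pathEval 0, p₁ := Y.pathEval 1, ι := Y.pathConst
             ι_p₀ := rfl, ι_p₁ := rfl
             weakEquivalence_ι := ⟨dihomotopyEquivalences_pathConst Y⟩ },
      ⟨{ h := h, h₀ := h₀, h₁ := h₁ }⟩⟩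

end ModelCategory

end PoTop

end

/-- Pospaces form a closed model category in which the weak equivalences, fibrations and
cofibrations are the dihomotopy equivalences, difibrations and dicofibrations; every pospace is
fibrant and cofibrant, and both the left and the right homotopy relation of this model category
are dihomotopy. -/
theorem theorem8p2 :
    ∃ _ : ModelCategory PoTop.{u},
      weakEquivalences PoTop.{u} = PoTop.dihomotopyEquivalences ∧
      fibrations PoTop.{u} = PoTop.difibrations ∧
      cofibrations PoTop.{u} = PoTop.dicofibrations ∧
      (∀ X : PoTop.{u}, IsFibrant X ∧ IsCofibrant X) ∧
      ∀ {X Y : PoTop.{u}} (f g : X ⟶ Y),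
        (LeftHomotopyRel f g ↔ PoTop.Dihomotopic f g) ∧
        (RightHomotopyRel f g ↔ PoTop.Dihomotopic f g) :=
  ⟨PoTop.modelCategory, rfl, rfl, rfl,
    fun X => ⟨PoTop.isFibrant_of_pospace X, PoTop.isCofibrant_of_pospace X⟩,
    fun f g => ⟨PoTop.leftHomotopyRel_iff f g, PoTop.rightHomotopyRel_iff f g⟩⟩
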